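/- Units are chosen so that the gravitational constant is $1$. Bodies with masses $\mu_1,\dots,\mu_N\ge 0$ at pairwise distinct positions $q_1,\dots,q_N\in\mathbb R^3$ form a central configuration with constant $\lambda\in\mathbb R$ if the Newtonian acceleration of every body is $\lambda$ times its position, that is, $$-\sum_{j\neq i}\frac{\mu_j\,(q_i-q_j)}{|q_i-q_j|^3}=\lambda q_i\qquad (i=1,\dots,N).$$ For $n\in\mathbb N$, an integer $\ell\ge 2$, masses $m_0\ge 0$ and $m_1,\dots,m_n>0$, and radii $r=(r_1,\dots,r_n)$ with $0<r_1<\dots<r_n$, the $n\times\ell+1$ spiderweb configuration consists of a body of mass $m_0$ at the origin and, for each $i\in\{1,\dots,n\}$ and $k\in\{0,\dots,\ell-1\}$, a body of mass $m_i$ at the point $\bigl(r_i\cos\tfrac{2\pi k}{\ell},\,r_i\sin\tfrac{2\pi k}{\ell},\,0\bigr)$. **Theorem.** Let $n\in\mathbb N$, $m_0\ge 0$, $m_1,\dots,m_n>0$, and let $\lambda<0$ be fixed. 1. If $\ell\in\{2,\dots,9\}$, then there is exactly one $r=(r_1,\dots,r_n)$ with $0<r_1<\dots<r_n$ such that the $n\times\ell+1$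 spiderweb configuration is central with constant $\lambda$. 2. If $m_1\ge m_2\ge\dots\ge m_n$, then there is likewise exactly one such $r$ in each of the following cases: $\ell=10$ and $n\le 17$; $\ell=11$ and $n\le 9$; $\ell=12$ and $n\le 6$; $\ell=13$ and $n\le 5$; $\ell\in\{14,15\}$ and $n\le 4$; $\ell\in\{16,17,18\}$ and $n\le 3$. -/

import Mathlib

noncomputable section

namespace Spiderweb

open scoped BigOperators

/-- The acceleration that Newton's law of gravitation (with gravitational constant `1`)
gives to the `i`-th of finitely many bodies with masses `m` and positions `q`:
`- ∑_{j ≠ i} m_j (q_i - q_j) / |q_i - q_j| ^ 3`. -/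
def gravAccel {ι : Type*} [Fintype ι] [DecidableEq ι] (m : ι → ℝ)
    (q : ι → EuclideanSpace ℝ (Fin 3)) (i : ι) : EuclideanSpace ℝ (Fin 3) :=
  -∑ j ∈ Finset.univ.erase i, (m j / ‖q i - q j‖ ^ 3) • (q i - q j)

/-- The bodies with masses `m` and (pairwise distinct) positions `q` form a central
configuration with constant `lam`: the acceleration of every body is `lam` times its position. -/
def IsCentral {ι : Type*} [Fintype ι] [DecidableEq ι] (m : ι → ℝ)
    (q : ι → EuclideanSpace ℝ (Fin 3)) (lam : ℝ) : Prop :=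
  Function.Injective q ∧ ∀ i, gravAccel m q i = lam • q i

/-- The set of radius vectors `0 < r_1 < ... < r_n`. -/
def radii (n : ℕ) : Set (Fin n → ℝ) :=
  {r | (∀ i, 0 < r i) ∧ StrictMono r}

/-- Index set of the `n * ℓ + 1` bodies: `none` is the body at the origin, and `some (i, k)` is
the body on the `i`-th circle and the `k`-th half-line. -/
abbrev Body (n ℓ : ℕ) : Type := Option (Fin n × Fin ℓ)

/-- Masses: `m₀` at the origin, and `m i` for each of the `ℓ` bodies on the `i`-th circle. -/
def mass {n : ℕ} (ℓ : ℕ) (m₀ : ℝ) (m : Fin n → ℝ) : Body n ℓ → ℝ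
  | none => m₀
  | some (i, _) => m i

/-- Positions, in the horizontal plane of `ℝ³`: the origin, and the points at distance `r i`
from it on the half-lines at angles `2 π k / ℓ`, for `k = 0, ..., ℓ - 1`. -/
def position {n : ℕ} (ℓ : ℕ) (r : Fin n → ℝ) : Body n ℓ → EuclideanSpace ℝ (Fin 3)
  | none => 0
  | some (i, k) =>
      !₂[r i * Real.cos (2 * Real.pi * (k : ℕ) / ℓ), r i * Real.sin (2 * Real.pi * (k : ℕ) / ℓ), 0]

/-- The `n × ℓ + 1` spiderweb configuration with central mass `m₀`, masses `m` and radii `r` is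
central with constant `lam`. -/
def IsCentralSpiderweb {n : ℕ} (ℓ : ℕ) (m₀ : ℝ) (m : Fin n → ℝ) (lam : ℝ) (r : Fin n → ℝ) :
    Prop :=
  IsCentral (mass ℓ m₀ m) (position ℓ r) lam

end Spiderweb

end

/-!
Central configurations with constant `λ` are the critical points, among the admissible radii, of
the sign-reversed potential energy minus `λ / 2` times the moment of inertia. For `λ < 0` this
function tends to infinity at the boundary of the set of radii, that is, when a radius tends to
zero or infinity or two radii approach each other, so it attains its minimum.

It is strictly convex in the logarithms of the radii, hence has no second critical point. Indeed
the terms of a single ring are nonnegative multiples of exponentials of linear forms. The mutual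
energy of two rings is a sum of terms `|1 - z|⁻¹ = (1 - z) ^ (-1/2) * (1 - conj z) ^ (-1/2)`,
divided by the outer radius, where `z` is the ratio of the radii times a vertex of the regular
`ℓ`-gon. Both factors have nonnegative Taylor coefficients, and the sums of `ω ^ p * conj ω ^ q`
over the `ℓ`-th roots of unity `ω` are nonnegative; so the mutual energy is a convergent series,
with nonnegative coefficients, of exponentials of linear forms.
-/

noncomputable section

namespace Spiderweb

open Finset
open scoped ComplexConjugate Real

section Convexity

lemma convexOn_of_hasSum {ι E : Type*} [AddCommGroup E] [Module ℝ E] {S : Set E}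
    {f : ι → E → ℝ} {F : E → ℝ} (hS : Convex ℝ S)
    (hf : ∀ i, ConvexOn ℝ S (f i)) (hF : ∀ u ∈ S, HasSum (fun i => f i u) (F u)) :
    ConvexOn ℝ S F :=
  ⟨hS, fun _ hu _ hv _ _ ha hb hab =>
    hasSum_le (fun i => (hf i).2 hu hv ha hb hab) (hF _ (hS hu hv ha hb hab))
      (((hF _ hu).const_smul _).add ((hF _ hv).const_smul _))⟩

lemma convexOn_finsetSum {ι E : Type*} [AddCommGroup E] [Module ℝ E] {S : Set E} {s : Finset ι}
    {f : ι → E → ℝ} (hS : Convex ℝ S) (hf : ∀ i ∈ s, ConvexOn ℝ S (f i)) :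
    ConvexOn ℝ S fun u => ∑ i ∈ s, f i u := by
  simpa only [Finset.sum_fn] using
    Finset.sum_induction f (ConvexOn ℝ S) (fun _ _ => ConvexOn.add) (convexOn_const 0 hS) hf

lemma strictConvexOn_sum_apply {ι : Type*} [Fintype ι] {E : ι → Type*}
    [∀ i, AddCommGroup (E i)] [∀ i, Module ℝ (E i)] {s : ∀ i, Set (E i)} {f : ∀ i, E i → ℝ}
    (hf : ∀ i, StrictConvexOn ℝ (s i) (f i)) :
    StrictConvexOn ℝ (Set.univ.pi s) fun u : ∀ i, E i => ∑ i, f i (u i) := by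
  refine ⟨convex_pi fun i _ => (hf i).1, fun u hu v hv huv a b ha hb hab => ?_⟩
  obtain ⟨i, hi⟩ := Function.ne_iff.1 huv
  simp only [smul_sum, ← sum_add_distrib]
  exact sum_lt_sum
    (fun j _ => (hf j).convexOn.2 (hu j trivial) (hv j trivial) ha.le hb.le hab)
    ⟨i, mem_univ i, (hf i).2 (hu i trivial) (hv i trivial) hi ha hb hab⟩

variable {E : Type*} [NormedAddCommGroup E] [NormedSpace ℝ E] {S : Set E}

lemma isMinOn_of_convexOn_of_hasFDerivAt_zero {f : E → ℝ} {u : E} (hf : ConvexOn ℝ S f)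
    (hu : u ∈ S) (hd : HasFDerivAt f (0 : E →L[ℝ] ℝ) u) : IsMinOn f S u := by
  intro v hv
  let γ : ℝ →ᵃ[ℝ] E := AffineMap.lineMap u v
  have hγ0 : γ 0 = u := AffineMap.lineMap_apply_zero u v
  have hγ1 : γ 1 = v := AffineMap.lineMap_apply_one u v
  have hderiv : HasDerivAt (f ∘ γ) 0 0 :=
    HasFDerivAt.comp_hasDerivAt (f' := v - u) (l' := 0) (0 : ℝ) (hγ0 ▸ hd)
      AffineMap.hasDerivAt_lineMap
  have hslope := (hf.comp_affineMap γ).le_slope_of_hasDerivAt (x := 0) (y := 1)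
    (by simpa [hγ0] using hu) (by simpa [hγ1] using hv) one_pos hderiv
  simpa [slope_def_field, hγ0, hγ1] using hslope

lemma eq_of_strictConvexOn_of_hasFDerivAt_zero {f : E → ℝ} {u v : E} (hf : StrictConvexOn ℝ S f)
    (hu : u ∈ S) (hv : v ∈ S) (hfu : HasFDerivAt f (0 : E →L[ℝ] ℝ) u)
    (hfv : HasFDerivAt f (0 : E →L[ℝ] ℝ) v) : u = v :=
  hf.eq_of_isMinOn (isMinOn_of_convexOn_of_hasFDerivAt_zero hf.convexOn hu hfu)
    (isMinOn_of_convexOn_of_hasFDerivAt_zero hf.convexOn hv hfv) hu hv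

end Convexity

section Vertices

/-- The vertices `ω_k = exp (2πik/ℓ)` of the regular `ℓ`-gon inscribed in the unit circle of `ℂ`.
The spiderweb lies in a plane, which is identified with `ℂ` so that rotating it by an angle
`2πk/ℓ` is multiplication by `ω_k`. -/
def vertex (ℓ : ℕ) (k : Fin ℓ) : ℂ := Complex.exp (2 * π * Complex.I / ℓ) ^ (k : ℕ)

variable {ℓ : ℕ}

lemma vertex_eq_exp (k : Fin ℓ) :
    vertex ℓ k = Complex.exp ((2 * π * (k : ℕ) / ℓ : ℝ) * Complex.I) := by
  rw [vertex, ← Complex.exp_nat_mul]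
  congr 1
  push_cast
  ring

lemma re_vertex (k : Fin ℓ) : (vertex ℓ k).re = Real.cos (2 * π * (k : ℕ) / ℓ) := by
  rw [vertex_eq_exp, Complex.exp_ofReal_mul_I_re]

lemma im_vertex (k : Fin ℓ) : (vertex ℓ k).im = Real.sin (2 * π * (k : ℕ) / ℓ) := by
  rw [vertex_eq_exp, Complex.exp_ofReal_mul_I_im]

@[simp]
lemma norm_vertex (k : Fin ℓ) : ‖vertex ℓ k‖ = 1 := by
  rw [vertex_eq_exp, Complex.norm_exp_ofReal_mul_I]

lemma vertex_injective : Function.Injective (vertex ℓ) := fun a b h =>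
  Fin.ext ((Complex.isPrimitiveRoot_exp ℓ a.pos.ne').pow_inj a.isLt b.isLt h)

@[simp]
lemma vertex_zero [NeZero ℓ] : vertex ℓ 0 = 1 := by simp [vertex]

lemma vertex_add [NeZero ℓ] (a b : Fin ℓ) : vertex ℓ (a + b) = vertex ℓ a * vertex ℓ b := by
  rw [vertex, Fin.val_add, vertex, vertex, ← pow_add,
    ← pow_mod_orderOf, ← pow_mod_orderOf _ ((a : ℕ) + b),
    ← (Complex.isPrimitiveRoot_exp ℓ (NeZero.ne ℓ)).eq_orderOf, Nat.mod_mod]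

lemma vertex_neg [NeZero ℓ] (k : Fin ℓ) : vertex ℓ (-k) = conj (vertex ℓ k) := by
  rw [← Complex.inv_eq_conj (norm_vertex k)]
  exact eq_inv_of_mul_eq_one_left (by rw [← vertex_add, neg_add_cancel, vertex_zero])

lemma sum_vertex (hℓ : 2 ≤ ℓ) : ∑ k, vertex ℓ k = 0 := by
  simpa only [vertex, ← Fin.sum_univ_eq_sum_range] using
    (Complex.isPrimitiveRoot_exp ℓ (by lia)).geom_sum_eq_zero hℓ

lemma norm_sub_mul_vertex (x y : ℝ) (k : Fin ℓ) :
    ‖(x - y * vertex ℓ k : ℂ)‖ = √(x ^ 2 + y ^ 2 - 2 * x * y * (vertex ℓ k).re) := by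
  have hre_im : (vertex ℓ k).re ^ 2 + (vertex ℓ k).im ^ 2 = 1 := by
    rw [re_vertex, im_vertex, Real.cos_sq_add_sin_sq]
  rw [Complex.norm_eq_sqrt_sq_add_sq]
  congr 1
  simp only [Complex.sub_re, Complex.sub_im, Complex.ofReal_re, Complex.ofReal_im,
    Complex.re_ofReal_mul, Complex.im_ofReal_mul]
  linear_combination y ^ 2 * hre_im

lemma norm_sub_mul_vertex_comm (x y : ℝ) (k : Fin ℓ) :
    ‖(x - y * vertex ℓ k : ℂ)‖ = ‖(y - x * vertex ℓ k : ℂ)‖ := by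
  rw [norm_sub_mul_vertex, norm_sub_mul_vertex]
  ring_nf

lemma eq_of_mul_vertex_eq {x y : ℝ} {j k : Fin ℓ} (hx : 0 < x) (hy : 0 < y)
    (h : (x * vertex ℓ j : ℂ) = y * vertex ℓ k) : x = y ∧ j = k := by
  have hxy : x = y := by
    simpa [abs_of_pos hx, abs_of_pos hy] using congrArg norm h
  subst hxy
  exact ⟨rfl, vertex_injective (mul_left_cancel₀ (Complex.ofReal_ne_zero.2 hx.ne') h)⟩

end Vertices

section Gravity

/-- The horizontal plane of `ℝ³`, as an isometric image of `ℂ`. -/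
def planeIsometry : ℂ →ₗᵢ[ℝ] EuclideanSpace ℝ (Fin 3) where
  toFun z := !₂[z.re, z.im, 0]
  map_add' z w := by ext a; fin_cases a <;> simp
  map_smul' c z := by ext a; fin_cases a <;> simp
  norm_map' z := by
    simp [EuclideanSpace.norm_eq, Fin.sum_univ_three, Complex.norm_eq_sqrt_sq_add_sq]

/-- The positions of the bodies of a spiderweb, seen in the complex plane. -/
def planarPosition {n : ℕ} (ℓ : ℕ) (r : Fin n → ℝ) : Body n ℓ → ℂ
  | none => 0
  | some (i, k) => r i * vertex ℓ k

/-- The inward radial force that a regular `ℓ`-gon of radius `y` with unit masses exerts on a unit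
mass at distance `x` from the centre on the ray through one of the vertices. If `x = y`, that vertex
itself contributes `0 / 0 = 0`, so the formula also gives the force of a ring on its own bodies. -/
def ringForce (ℓ : ℕ) (x y : ℝ) : ℝ :=
  ∑ k : Fin ℓ, (x - y * (vertex ℓ k).re) / ‖(x - y * vertex ℓ k : ℂ)‖ ^ 3

/-- The outward radial component of the acceleration of the bodies on the `i`-th circle. -/
def radialAccel {n : ℕ} (ℓ : ℕ) (m₀ : ℝ) (m r : Fin n → ℝ) (i : Fin n) : ℝ :=
  -(m₀ / r i ^ 2 + ∑ j, m j * ringForce ℓ (r i) (r j))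

variable {n ℓ : ℕ}

lemma position_eq_planeIsometry_comp (r : Fin n → ℝ) :
    position ℓ r = planeIsometry ∘ planarPosition ℓ r := by
  funext b
  rcases b with _ | ⟨i, k⟩
  · exact (map_zero planeIsometry).symm
  · simp [position, planarPosition, planeIsometry, re_vertex, im_vertex]

lemma gravAccel_isometry_comp {ι E : Type*} [Fintype ι] [DecidableEq ι] [NormedAddCommGroup E]
    [NormedSpace ℝ E] (f : E →ₗᵢ[ℝ] EuclideanSpace ℝ (Fin 3)) (m : ι → ℝ) (z : ι → E) (i : ι) :
    gravAccel m (f ∘ z) i = f (-∑ j, (m j / ‖z i - z j‖ ^ 3) • (z i - z j)) := by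
  have hself : (m i / ‖z i - z i‖ ^ 3) • (z i - z i) = 0 := by rw [sub_self, smul_zero]
  simp only [gravAccel, Function.comp_apply, ← map_sub, f.norm_map, ← map_smul, ← map_sum,
    ← map_neg]
  rw [sum_erase (f := fun j => (m j / ‖z i - z j‖ ^ 3) • (z i - z j)) univ hself]

lemma sum_im_vertex_div_norm_pow (x y : ℝ) :
    ∑ k : Fin ℓ, (vertex ℓ k).im / ‖(x - y * vertex ℓ k : ℂ)‖ ^ 3 = 0 := by
  rcases Nat.eq_zero_or_pos ℓ with rfl | hℓ
  · simp
  have : NeZero ℓ := ⟨hℓ.ne'⟩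
  rw [← self_eq_neg, ← sum_neg_distrib, ← Equiv.sum_comp (Equiv.neg (Fin ℓ))]
  simp only [norm_sub_mul_vertex]
  simp only [Equiv.neg_apply, vertex_neg, Complex.conj_im, Complex.conj_re, neg_div]

lemma sum_sub_mul_vertex_div_norm_pow (x y : ℝ) :
    ∑ k : Fin ℓ, (1 / ‖(x - y * vertex ℓ k : ℂ)‖ ^ 3) • (x - y * vertex ℓ k : ℂ) =
      ringForce ℓ x y := by
  apply Complex.ext
  · simp only [Complex.re_sum, Complex.smul_re, Complex.sub_re, Complex.ofReal_re,
      Complex.re_ofReal_mul, smul_eq_mul, one_div_mul_eq_div, ringForce]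
  · simp only [Complex.im_sum, Complex.smul_im, Complex.sub_im, Complex.ofReal_im,
      Complex.im_ofReal_mul, smul_eq_mul, one_div_mul_eq_div, zero_sub, neg_div, mul_div_assoc,
      sum_neg_distrib, ← mul_sum, sum_im_vertex_div_norm_pow, mul_zero, neg_zero]

lemma ring_attraction (x y : ℝ) (k : Fin ℓ) :
    ∑ k' : Fin ℓ, (1 / ‖(x * vertex ℓ k - y * vertex ℓ k' : ℂ)‖ ^ 3) •
      (x * vertex ℓ k - y * vertex ℓ k' : ℂ) = ringForce ℓ x y * vertex ℓ k := by
  have : NeZero ℓ := ⟨k.pos.ne'⟩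
  have hrotate (d : Fin ℓ) : (x * vertex ℓ k - y * vertex ℓ (d + k) : ℂ) =
      (x - y * vertex ℓ d) * vertex ℓ k := by
    rw [vertex_add]
    ring
  rw [← Equiv.sum_comp (Equiv.addRight k), ← sum_sub_mul_vertex_div_norm_pow, sum_mul]
  simp only [Equiv.coe_addRight, hrotate, norm_mul, norm_vertex, mul_one, smul_mul_assoc]

lemma gravAccel_some (m₀ : ℝ) (m : Fin n → ℝ) {r : Fin n → ℝ} {i : Fin n} (hr : 0 < r i)
    (k : Fin ℓ) :
    gravAccel (mass ℓ m₀ m) (position ℓ r) (some (i, k)) =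
      planeIsometry (radialAccel ℓ m₀ m r i * vertex ℓ k) := by
  have hcentre : (m₀ / ‖(r i * vertex ℓ k : ℂ)‖ ^ 3) • (r i * vertex ℓ k : ℂ) =
      (m₀ / r i ^ 2 : ℝ) * vertex ℓ k := by
    have : (r i : ℂ) ≠ 0 := Complex.ofReal_ne_zero.2 hr.ne'
    rw [norm_mul, norm_vertex, mul_one, Complex.norm_of_nonneg hr.le, Complex.real_smul]
    push_cast
    field_simp
  have hring (j : Fin n) : ∑ k' : Fin ℓ,
      (m j / ‖(r i * vertex ℓ k - r j * vertex ℓ k' : ℂ)‖ ^ 3) •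
        (r i * vertex ℓ k - r j * vertex ℓ k' : ℂ) =
      (m j * ringForce ℓ (r i) (r j) : ℝ) * vertex ℓ k := by
    simp only [← mul_one_div (m j), mul_smul, ← smul_sum, ring_attraction]
    rw [Complex.real_smul]
    push_cast
    ring
  rw [position_eq_planeIsometry_comp, gravAccel_isometry_comp, Fintype.sum_option,
    Fintype.sum_prod_type]
  simp only [planarPosition, mass, sub_zero, hcentre, hring, ← sum_mul, ← add_mul, ← neg_mul]
  simp only [radialAccel, Complex.ofReal_neg, Complex.ofReal_add, Complex.ofReal_sum]

lemma gravAccel_none (hℓ : 2 ≤ ℓ) (m₀ : ℝ) (m r : Fin n → ℝ) :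
    gravAccel (mass ℓ m₀ m) (position ℓ r) none = 0 := by
  rw [position_eq_planeIsometry_comp, gravAccel_isometry_comp, Fintype.sum_option,
    Fintype.sum_prod_type]
  simp only [planarPosition, mass, sub_zero, zero_sub, norm_neg, norm_mul, norm_vertex, mul_one,
    ← smul_sum, ← mul_sum, sum_neg_distrib, sum_vertex hℓ, mul_zero, neg_zero, smul_zero,
    sum_const_zero, add_zero, map_zero]

lemma planarPosition_injective {r : Fin n → ℝ} (hr : r ∈ radii n) :
    Function.Injective (planarPosition ℓ r) := by
  have hne (i : Fin n) (k : Fin ℓ) : (r i * vertex ℓ k : ℂ) ≠ 0 :=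
    norm_ne_zero_iff.1 (by simpa using (hr.1 i).ne')
  rintro (_ | ⟨i, k⟩) (_ | ⟨j, k'⟩) h
  · rfl
  · exact absurd h.symm (hne j k')
  · exact absurd h (hne i k)
  · obtain ⟨hij, rfl⟩ := eq_of_mul_vertex_eq (hr.1 i) (hr.1 j) h
    rw [hr.2.injective hij]

lemma isCentralSpiderweb_iff_radialAccel (hℓ : 2 ≤ ℓ) {m₀ lam : ℝ} {m r : Fin n → ℝ}
    (hr : r ∈ radii n) :
    IsCentralSpiderweb ℓ m₀ m lam r ↔ ∀ i, radialAccel ℓ m₀ m r i = lam * r i := by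
  have hinj : Function.Injective (position ℓ r) := by
    rw [position_eq_planeIsometry_comp]
    exact planeIsometry.injective.comp (planarPosition_injective hr)
  have hbody (i : Fin n) (k : Fin ℓ) :
      gravAccel (mass ℓ m₀ m) (position ℓ r) (some (i, k)) = lam • position ℓ r (some (i, k)) ↔
        radialAccel ℓ m₀ m r i = lam * r i := by
    have hk : vertex ℓ k ≠ 0 := norm_ne_zero_iff.1 (by simp)
    rw [gravAccel_some m₀ m (hr.1 i), position_eq_planeIsometry_comp, Function.comp_apply,
      ← map_smul, planeIsometry.injective.eq_iff, planarPosition, Complex.real_smul, ← mul_assoc,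
      mul_left_inj' hk]
    norm_cast
  have hcentre :
      gravAccel (mass ℓ m₀ m) (position ℓ r) none = lam • position ℓ r none := by
    rw [gravAccel_none hℓ, show position ℓ r none = 0 from rfl, smul_zero]
  have : Nonempty (Fin ℓ) := ⟨⟨0, by lia⟩⟩
  simp only [IsCentralSpiderweb, IsCentral, Option.forall, Prod.forall, hinj, hcentre, hbody,
    true_and, forall_const]

end Gravity

section Energy

/-- The Newtonian potential of a regular `ℓ`-gon of radius `y` with unit masses, at distance `x`
from the centre on the ray through one of the vertices (with the sign that makes it positive). -/
def ringPotential (ℓ : ℕ) (x y : ℝ) : ℝ := ∑ k : Fin ℓ, ‖(x - y * vertex ℓ k : ℂ)‖⁻¹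

/-- The contribution to `energy` of one ring of radius `x` with `ℓ` bodies of mass `μ`: its energy
in the fields of the central body and of the ring itself, and its share of the moment of inertia.
The self-energy `μ ^ 2 * ringForce ℓ 1 1 / x` is half of `μ ^ 2` times the potential of the ring
at its own vertices, each of the pairs of bodies being counted once. -/
def ringEnergy (ℓ : ℕ) (m₀ μ lam x : ℝ) : ℝ :=
  μ * (m₀ + μ * ringForce ℓ 1 1) / x - lam / 2 * μ * x ^ 2

/-- The function of the radii whose critical points are the central configurations: per half-line,
the (sign-reversed) potential energy minus `lam / 2` times the moment of inertia. -/
def energy {n : ℕ} (ℓ : ℕ) (m₀ : ℝ) (m : Fin n → ℝ) (lam : ℝ) (r : Fin n → ℝ) : ℝ :=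
  ∑ i, ringEnergy ℓ m₀ (m i) lam (r i) +
    ∑ i, ∑ j ∈ Ioi i, m i * m j * ringPotential ℓ (r i) (r j)

variable {n ℓ : ℕ}

lemma norm_mul_sub_mul_mul_vertex {t : ℝ} (ht : 0 ≤ t) (x y : ℝ) (k : Fin ℓ) :
    ‖((t * x : ℝ) - (t * y : ℝ) * vertex ℓ k : ℂ)‖ = t * ‖(x - y * vertex ℓ k : ℂ)‖ := by
  rw [Complex.ofReal_mul, Complex.ofReal_mul, mul_assoc, ← mul_sub, norm_mul,
    Complex.norm_of_nonneg ht]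

lemma ringForce_mul {t : ℝ} (ht : 0 < t) (x y : ℝ) :
    ringForce ℓ (t * x) (t * y) = ringForce ℓ x y / t ^ 2 := by
  simp only [ringForce, norm_mul_sub_mul_mul_vertex ht.le, mul_assoc, ← mul_sub, sum_div, mul_pow]
  refine sum_congr rfl fun k _ => ?_
  rw [pow_succ t 2, mul_right_comm, mul_comm t, mul_div_mul_right _ _ ht.ne', mul_comm (t ^ 2),
    div_mul_eq_div_div]

lemma ringForce_self {x : ℝ} (hx : 0 < x) : ringForce ℓ x x = ringForce ℓ 1 1 / x ^ 2 := by
  simpa only [mul_one] using ringForce_mul (ℓ := ℓ) hx 1 1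

lemma ringForce_one_one_pos (hℓ : 2 ≤ ℓ) : 0 < ringForce ℓ 1 1 := by
  have : NeZero ℓ := ⟨by lia⟩
  let k₁ : Fin ℓ := ⟨1, hℓ⟩
  have hk₁ : vertex ℓ k₁ ≠ 1 :=
    vertex_zero (ℓ := ℓ) ▸ vertex_injective.ne (by simp [k₁, Fin.ext_iff])
  have hdist : 0 < ‖((1 : ℝ) - (1 : ℝ) * vertex ℓ k₁ : ℂ)‖ := by
    simpa [sub_eq_zero] using hk₁.symm
  have hre : 0 < 1 - 1 * (vertex ℓ k₁).re := by
    rw [norm_sub_mul_vertex, Real.sqrt_pos] at hdist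
    linarith
  refine sum_pos' (fun k _ => div_nonneg ?_ (by positivity))
    ⟨k₁, mem_univ _, div_pos hre (by positivity)⟩
  linarith [norm_vertex k ▸ Complex.re_le_norm (vertex ℓ k)]

lemma ringPotential_comm (x y : ℝ) : ringPotential ℓ x y = ringPotential ℓ y x := by
  simp only [ringPotential, norm_sub_mul_vertex_comm x y]

variable {E : Type*} [NormedAddCommGroup E] [NormedSpace ℝ E]

lemma hasFDerivAt_inv_norm_sub_mul_vertex {f g : E → ℝ} {f' g' : E →L[ℝ] ℝ} {u : E} {k : Fin ℓ}
    (hf : HasFDerivAt f f' u) (hg : HasFDerivAt g g' u)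
    (hfg : (f u - g u * vertex ℓ k : ℂ) ≠ 0) :
    HasFDerivAt (fun v => ‖(f v - g v * vertex ℓ k : ℂ)‖⁻¹)
      (-(((f u - g u * (vertex ℓ k).re) / ‖(f u - g u * vertex ℓ k : ℂ)‖ ^ 3) • f' +
        ((g u - f u * (vertex ℓ k).re) / ‖(g u - f u * vertex ℓ k : ℂ)‖ ^ 3) • g')) u := by
  have hpos := norm_pos_iff.2 hfg
  rw [norm_sub_mul_vertex_comm (g u)]
  simp only [norm_sub_mul_vertex] at hpos ⊢
  set c := (vertex ℓ k).re
  have hsq : HasFDerivAt (fun v => f v ^ 2 + g v ^ 2 - 2 * f v * g v * c)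
      ((2 * (f u - g u * c)) • f' + (2 * (g u - f u * c)) • g') u := by
    refine (((hf.pow 2).add (hg.pow 2)).sub
      (((hf.const_mul 2).mul hg).mul_const c)).congr_fderiv ?_
    ext v
    simp only [Nat.add_one_sub_one, pow_one, nsmul_eq_mul, Nat.cast_ofNat, smul_add, sub_apply,
      add_apply, smul_apply, smul_eq_mul]
    ring
  refine ((hasDerivAt_inv hpos.ne').comp_hasFDerivAt u
    (hsq.sqrt (Real.sqrt_pos.1 hpos).ne')).congr_fderiv ?_
  ext v
  simp only [one_div, mul_inv_rev, smul_add, neg_smul, add_apply, neg_apply, smul_apply,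
    smul_eq_mul, neg_add_rev]
  field_simp
  ring

lemma hasFDerivAt_ringPotential {f g : E → ℝ} {f' g' : E →L[ℝ] ℝ} {u : E}
    (hf : HasFDerivAt f f' u) (hg : HasFDerivAt g g' u) (hfg : |f u| ≠ |g u|) :
    HasFDerivAt (fun v => ringPotential ℓ (f v) (g v))
      (-(ringForce ℓ (f u) (g u) • f' + ringForce ℓ (g u) (f u) • g')) u := by
  have hne (k : Fin ℓ) : (f u - g u * vertex ℓ k : ℂ) ≠ 0 := fun h => hfg <| by
    simpa using congrArg norm (sub_eq_zero.1 h)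
  refine (HasFDerivAt.fun_sum fun k _ =>
    hasFDerivAt_inv_norm_sub_mul_vertex hf hg (hne k)).congr_fderiv ?_
  simp only [sum_neg_distrib, sum_add_distrib, ← sum_smul, ringForce]

lemma hasDerivAt_ringEnergy (m₀ μ lam : ℝ) {x : ℝ} (hx : 0 < x) :
    HasDerivAt (ringEnergy ℓ m₀ μ lam)
      (μ * (-(m₀ / x ^ 2 + μ * ringForce ℓ x x) - lam * x)) x := by
  refine (((hasDerivAt_const x _).div (hasDerivAt_id x) hx.ne').sub
    ((hasDerivAt_pow 2 x).const_mul _)).congr_deriv ?_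
  rw [ringForce_self hx]
  simp only [id_eq, zero_mul, mul_one, zero_sub, Nat.cast_ofNat, Nat.add_one_sub_one, pow_one,
    neg_add_rev]
  field_simp
  ring

lemma hasFDerivAt_energy (m₀ : ℝ) (m : Fin n → ℝ) (lam : ℝ) {r : Fin n → ℝ} (hr : r ∈ radii n) :
    HasFDerivAt (energy ℓ m₀ m lam)
      (∑ i, (m i * (radialAccel ℓ m₀ m r i - lam * r i)) •
        (ContinuousLinearMap.proj i : (Fin n → ℝ) →L[ℝ] ℝ)) r := by
  have hring (i : Fin n) := (hasDerivAt_ringEnergy (ℓ := ℓ) m₀ (m i) lam (hr.1 i)).comp_hasFDerivAt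
    r (hasFDerivAt_apply (𝕜 := ℝ) i r)
  have hpair (i j : Fin n) (hij : j ∈ Ioi i) :=
    (hasFDerivAt_ringPotential (ℓ := ℓ) (hasFDerivAt_apply (𝕜 := ℝ) i r) (hasFDerivAt_apply j r)
      (by simpa [abs_of_pos, hr.1] using (hr.2 (mem_Ioi.1 hij)).ne)).const_mul (m i * m j)
  refine ((HasFDerivAt.fun_sum fun i _ => hring i).add
    (HasFDerivAt.fun_sum fun i _ => HasFDerivAt.fun_sum (hpair i))).congr_fderiv ?_
  ext v
  have hoffdiag : ∑ i, ∑ j ∈ Ioi i, m i * m j *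
        (ringForce ℓ (r i) (r j) * v i + ringForce ℓ (r j) (r i) * v j) =
      ∑ i, ∑ j ∈ {i}ᶜ, m i * m j * ringForce ℓ (r i) (r j) * v i := by
    rw [← sum_sum_Ioi_add_eq_sum_sum_off_diag
      fun j i => m i * m j * ringForce ℓ (r i) (r j) * v i]
    exact sum_congr rfl fun i _ => sum_congr rfl fun j _ => by ring
  have hdiag (i : Fin n) : m i * (radialAccel ℓ m₀ m r i - lam * r i) * v i =
      m i * (-(m₀ / r i ^ 2 + m i * ringForce ℓ (r i) (r i)) - lam * r i) * v i -
        ∑ j ∈ {i}ᶜ, m i * m j * ringForce ℓ (r i) (r j) * v i := by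
    simp only [radialAccel, Fintype.sum_eq_add_sum_compl i, ← sum_mul, mul_assoc (m i), ← mul_sum]
    ring
  simp only [add_apply, _root_.sum_apply, smul_apply, neg_apply, ContinuousLinearMap.proj_apply,
    smul_eq_mul, mul_neg, sum_neg_distrib, ← sub_eq_add_neg]
  simp only [hdiag, sum_sub_distrib, hoffdiag]

lemma isCentralSpiderweb_iff_hasFDerivAt_energy_zero (hℓ : 2 ≤ ℓ) {m₀ lam : ℝ} {m r : Fin n → ℝ}
    (hm : ∀ i, m i ≠ 0) (hr : r ∈ radii n) :
    IsCentralSpiderweb ℓ m₀ m lam r ↔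
      HasFDerivAt (energy ℓ m₀ m lam) (0 : (Fin n → ℝ) →L[ℝ] ℝ) r := by
  have hd := hasFDerivAt_energy (ℓ := ℓ) m₀ m lam hr
  rw [isCentralSpiderweb_iff_radialAccel hℓ hr]
  refine ⟨fun h => hd.congr_fderiv (by simp [h]), fun h i => ?_⟩
  simpa [Pi.single_apply, hm, sub_eq_zero] using DFunLike.congr_fun (hd.unique h) (Pi.single i 1)

end Energy

section LogConvexity

/-- The Taylor coefficients of `(1 - z) ^ (-1 / 2)`. -/
def invSqrtCoeff (p : ℕ) : ℝ := Ring.choose ((1 / 2 : ℝ) + p - 1) p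

/-- The sum of `ω ^ p * conj ω ^ q` over the vertices `ω` of the regular `ℓ`-gon, which are the
`ℓ`-th roots of unity; the sum is real. -/
def vertexMoment (ℓ p q : ℕ) : ℝ := ∑ k : Fin ℓ, (vertex ℓ k ^ p * conj (vertex ℓ k) ^ q).re

lemma invSqrtCoeff_nonneg (p : ℕ) : 0 ≤ invSqrtCoeff p := by
  have hfactorial := Ring.factorial_nsmul_multichoose_eq_ascPochhammer (1 / 2 : ℝ) p
  rw [Ring.multichoose_eq, ← invSqrtCoeff, nsmul_eq_mul,
    Polynomial.ascPochhammer_smeval_eq_eval] at hfactorial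
  have hpos := ascPochhammer_pos p (1 / 2 : ℝ) (by norm_num)
  rw [← hfactorial] at hpos
  exact (pos_of_mul_pos_right hpos (by positivity)).le

lemma hasSum_invSqrtCoeff {z : ℂ} (hz : ‖z‖ < 1) :
    HasSum (fun p => (invSqrtCoeff p : ℂ) * z ^ p) (1 / (1 - z) ^ (1 / 2 : ℂ)) := by
  have hseries := (Complex.one_div_one_sub_cpow_hasFPowerSeriesOnBall_zero (1 / 2)).hasSum (y := z)
    (by simpa [Metric.mem_eball, edist_eq_enorm_sub, ← ofReal_norm] using hz)
  simpa only [zero_add, FormalMultilinearSeries.ofScalars_apply_eq, smul_eq_mul, invSqrtCoeff,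
    Complex.ofReal_choose, Complex.ofReal_sub, Complex.ofReal_add, Complex.ofReal_div,
    Complex.ofReal_one, Complex.ofReal_ofNat, Complex.ofReal_natCast] using hseries

lemma summable_norm_invSqrtCoeff_mul_pow {z : ℂ} (hz : ‖z‖ < 1) :
    Summable fun p => ‖(invSqrtCoeff p : ℂ) * z ^ p‖ := by
  simpa using (hasSum_invSqrtCoeff (z := (‖z‖ : ℂ)) (by simpa using hz)).summable.norm

lemma inv_sqrt_mul_inv_sqrt_conj {z : ℂ} (hz : ‖z‖ < 1) :
    1 / (1 - z) ^ (1 / 2 : ℂ) * (1 / (1 - conj z) ^ (1 / 2 : ℂ)) = (‖1 - z‖⁻¹ : ℝ) := by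
  have harg : (1 - z).arg ≠ π := fun h => by
    have hre := (Complex.arg_eq_pi_iff.1 h).1
    rw [Complex.sub_re, Complex.one_re] at hre
    linarith [Complex.re_le_norm z]
  have hconj : (1 - conj z) ^ (1 / 2 : ℂ) = conj ((1 - z) ^ (1 / 2 : ℂ)) := by
    simpa only [map_sub, map_one, map_div₀, map_ofNat] using Complex.conj_cpow (1 - z) (1 / 2) harg
  have hnorm : ‖(1 - z) ^ (1 / 2 : ℂ)‖ = √‖1 - z‖ := by
    simpa [Real.sqrt_eq_rpow] using Complex.norm_cpow_real (1 - z) (1 / 2)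
  rw [hconj, one_div_mul_one_div, Complex.mul_conj, Complex.normSq_eq_norm_sq, hnorm,
    Real.sq_sqrt (norm_nonneg _), one_div, Complex.ofReal_inv]

lemma hasSum_inv_norm_one_sub {z : ℂ} (hz : ‖z‖ < 1) :
    HasSum (fun pq : ℕ × ℕ => invSqrtCoeff pq.1 * invSqrtCoeff pq.2 * (z ^ pq.1 * conj z ^ pq.2).re)
      ‖1 - z‖⁻¹ := by
  have hz' : ‖conj z‖ < 1 := by rwa [RCLike.norm_conj]
  have hsummable := summable_mul_of_summable_norm (summable_norm_invSqrtCoeff_mul_pow hz)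
    (summable_norm_invSqrtCoeff_mul_pow hz')
  have hprod := HasSum.mul (hasSum_invSqrtCoeff hz) (hasSum_invSqrtCoeff hz') hsummable
  rw [inv_sqrt_mul_inv_sqrt_conj hz] at hprod
  refine (Complex.hasSum_re hprod).congr_fun fun pq => ?_
  rw [mul_mul_mul_comm, ← Complex.ofReal_mul, Complex.re_ofReal_mul]

lemma vertexMoment_nonneg (ℓ p q : ℕ) : 0 ≤ vertexMoment ℓ p q := by
  rcases Nat.eq_zero_or_pos ℓ with rfl | hℓ
  · simp [vertexMoment]
  set ω := Complex.exp (2 * π * Complex.I / ℓ)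
  set w := ω ^ p * conj ω ^ q
  have hw : w ^ ℓ = 1 := by
    have hω : ω ^ ℓ = 1 := (Complex.isPrimitiveRoot_exp ℓ hℓ.ne').pow_eq_one
    simp only [w, mul_pow, pow_right_comm _ _ ℓ, ← map_pow, hω, one_pow, map_one, mul_one]
  have hgeom : vertexMoment ℓ p q = (∑ k ∈ range ℓ, w ^ k).re := by
    rw [← Fin.sum_univ_eq_sum_range, Complex.re_sum]
    simp only [vertexMoment, vertex, w, mul_pow, map_pow, pow_right_comm]
    rfl
  rw [hgeom]
  by_cases h1 : w = 1
  · simp [h1]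
  · rw [geom_sum_eq h1, hw]
    simp

lemma hasSum_ringPotential {ℓ : ℕ} {x : ℝ} (hx : |x| < 1) :
    HasSum (fun pq : ℕ × ℕ => invSqrtCoeff pq.1 * invSqrtCoeff pq.2 * vertexMoment ℓ pq.1 pq.2 *
      x ^ (pq.1 + pq.2)) (ringPotential ℓ 1 x) := by
  have hvertex (k : Fin ℓ) := hasSum_inv_norm_one_sub (z := x * vertex ℓ k) (by simpa using hx)
  have hterm (k : Fin ℓ) (p q : ℕ) : ((x * vertex ℓ k) ^ p * conj (x * vertex ℓ k) ^ q).re =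
      (vertex ℓ k ^ p * conj (vertex ℓ k) ^ q).re * x ^ (p + q) := by
    rw [map_mul, Complex.conj_ofReal, mul_pow, mul_pow, mul_mul_mul_comm, ← pow_add,
      ← Complex.ofReal_pow, Complex.re_ofReal_mul, mul_comm]
  simpa only [hterm, ← mul_assoc, ← mul_sum, ← sum_mul, vertexMoment, ringPotential,
    Complex.ofReal_one] using hasSum_sum fun k (_ : k ∈ univ) => hvertex k

lemma ringPotential_mul {ℓ : ℕ} {t : ℝ} (ht : 0 ≤ t) (x y : ℝ) :
    ringPotential ℓ (t * x) (t * y) = t⁻¹ * ringPotential ℓ x y := by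
  simp only [ringPotential, norm_mul_sub_mul_mul_vertex ht, mul_inv, mul_sum]

lemma hasSum_ringPotential_exp {ℓ : ℕ} {a b : ℝ} (hab : a < b) :
    HasSum (fun pq : ℕ × ℕ => invSqrtCoeff pq.1 * invSqrtCoeff pq.2 * vertexMoment ℓ pq.1 pq.2 *
      Real.exp (((pq.1 + pq.2 : ℕ) : ℝ) * (a - b) - b))
      (ringPotential ℓ (Real.exp a) (Real.exp b)) := by
  have hratio : |Real.exp (a - b)| < 1 := by
    rw [abs_of_pos (Real.exp_pos _), Real.exp_lt_one_iff]
    linarith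
  have hscale : (Real.exp b)⁻¹ * ringPotential ℓ 1 (Real.exp (a - b)) =
      ringPotential ℓ (Real.exp a) (Real.exp b) := by
    rw [← ringPotential_mul (Real.exp_pos b).le, ← Real.exp_add, add_sub_cancel, mul_one,
      ringPotential_comm]
  rw [← hscale]
  refine ((hasSum_ringPotential hratio).mul_left _).congr_fun fun pq => ?_
  rw [mul_left_comm, ← Real.exp_neg, ← Real.exp_nat_mul, ← Real.exp_add, neg_add_eq_sub]

lemma convexOn_ringPotential_exp {ℓ : ℕ} {E : Type*} [AddCommGroup E] [Module ℝ E] {S : Set E}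
    (hS : Convex ℝ S) (f g : E →ₗ[ℝ] ℝ) (hfg : ∀ u ∈ S, f u < g u) :
    ConvexOn ℝ S fun u => ringPotential ℓ (Real.exp (f u)) (Real.exp (g u)) := by
  refine convexOn_of_hasSum hS (fun pq => ?_) fun u hu => hasSum_ringPotential_exp (hfg u hu)
  refine ((convexOn_exp.comp_linearMap (((pq.1 + pq.2 : ℕ) : ℝ) • (f - g) - g)).subset
    (Set.subset_univ S) hS).smul (mul_nonneg
      (mul_nonneg (invSqrtCoeff_nonneg pq.1) (invSqrtCoeff_nonneg pq.2))
      (vertexMoment_nonneg ℓ pq.1 pq.2))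

lemma strictConvexOn_ringEnergy_exp {ℓ : ℕ} {m₀ μ lam : ℝ} (hA : 0 ≤ m₀ + μ * ringForce ℓ 1 1)
    (hμ : 0 < μ) (hlam : lam < 0) :
    StrictConvexOn ℝ Set.univ fun a => ringEnergy ℓ m₀ μ lam (Real.exp a) := by
  have hgrav : ConvexOn ℝ Set.univ fun a => (μ * (m₀ + μ * ringForce ℓ 1 1)) • Real.exp (-a) :=
    (convexOn_exp.comp_linearMap (-LinearMap.id)).smul (mul_nonneg hμ.le hA)
  have hinertia : StrictConvexOn ℝ Set.univ fun a => (-lam / 2 * μ) • Real.exp (2 * a) := by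
    refine ⟨convex_univ, fun a _ b _ hab p q hp hq hpq => ?_⟩
    have hexp := strictConvexOn_exp.2 (Set.mem_univ (2 * a)) (Set.mem_univ (2 * b))
      (by simpa using hab) hp hq hpq
    have hcoeff : 0 < -lam / 2 * μ := by nlinarith
    calc (-lam / 2 * μ) • Real.exp (2 * (p • a + q • b))
        = (-lam / 2 * μ) • Real.exp (p • (2 * a) + q • (2 * b)) := by
          simp only [smul_eq_mul]
          ring_nf
      _ < (-lam / 2 * μ) • (p • Real.exp (2 * a) + q • Real.exp (2 * b)) :=
          smul_lt_smul_of_pos_left hexp hcoeff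
      _ = _ := by rw [smul_add, smul_comm _ p, smul_comm _ q]
  refine (hgrav.add_strictConvexOn hinertia).congr fun a _ => ?_
  simp only [ringEnergy, Pi.add_apply, smul_eq_mul, Real.exp_neg, two_mul, Real.exp_add]
  ring

lemma convex_setOf_strictMono (ι : Type*) [Preorder ι] :
    Convex ℝ {u : ι → ℝ | StrictMono u} := by
  intro u hu v hv a b ha hb hab i j hij
  rcases ha.eq_or_lt with rfl | ha
  · simpa only [zero_add, zero_smul, (zero_add b).symm.trans hab, one_smul] using hv hij
  · exact add_lt_add_of_lt_of_le (mul_lt_mul_of_pos_left (hu hij) ha)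
      (mul_le_mul_of_nonneg_left (hv hij).le hb)

lemma strictConvexOn_energy_exp {n ℓ : ℕ} {m₀ lam : ℝ} {m : Fin n → ℝ}
    (hA : ∀ i, 0 ≤ m₀ + m i * ringForce ℓ 1 1) (hm : ∀ i, 0 < m i) (hlam : lam < 0) :
    StrictConvexOn ℝ {u : Fin n → ℝ | StrictMono u}
      fun u => energy ℓ m₀ m lam fun i => Real.exp (u i) := by
  have hS := convex_setOf_strictMono (Fin n)
  have hrings := (strictConvexOn_sum_apply fun i =>
    strictConvexOn_ringEnergy_exp (hA i) (hm i) hlam).subset (by simp) hS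
  have hpairs : ConvexOn ℝ {u : Fin n → ℝ | StrictMono u} fun u => ∑ i, ∑ j ∈ Ioi i,
      m i * m j * ringPotential ℓ (Real.exp (u i)) (Real.exp (u j)) :=
    convexOn_finsetSum hS fun i _ => convexOn_finsetSum hS fun j hj =>
      (convexOn_ringPotential_exp hS (LinearMap.proj i) (LinearMap.proj j)
        fun u hu => hu (mem_Ioi.1 hj)).smul (mul_pos (hm i) (hm j)).le
  exact hrings.add_convexOn hpairs

end LogConvexity

section Existence

lemma isOpen_radii (n : ℕ) : IsOpen (radii n) := by
  simp only [radii, StrictMono, Set.ofPred_and, Set.ofPred_forall]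
  refine (isOpen_iInter_of_finite fun i => isOpen_lt continuous_const (continuous_apply i)).inter ?_
  exact isOpen_iInter_of_finite fun i => isOpen_iInter_of_finite fun j =>
    isOpen_iInter_of_finite fun _ => isOpen_lt (continuous_apply i) (continuous_apply j)

lemma radii_nonempty (n : ℕ) : (radii n).Nonempty :=
  ⟨fun i => (i : ℕ) + 1, fun i => by positivity, fun i j hij => by simpa using hij⟩

lemma isCompact_setOf_gap_le {ι : Type*} [LT ι] (a b : ι → ℝ) (d : ι → ι → ℝ) :
    IsCompact {r : ι → ℝ | r ∈ Set.Icc a b ∧ ∀ i j, i < j → d i j ≤ r j - r i} := by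
  simp only [Set.ofPred_and, Set.ofPred_forall]
  exact isCompact_Icc.inter_right <| isClosed_iInter fun i => isClosed_iInter fun j =>
    isClosed_iInter fun _ => isClosed_le continuous_const (by fun_prop)

lemma inv_abs_sub_le_ringPotential {ℓ : ℕ} [NeZero ℓ] (x y : ℝ) :
    |x - y|⁻¹ ≤ ringPotential ℓ x y := by
  have hvertex := single_le_sum (s := univ) (f := fun k => ‖(x - y * vertex ℓ k : ℂ)‖⁻¹)
    (fun k _ => by positivity) (mem_univ 0)
  simpa only [ringPotential, vertex_zero, mul_one, ← Complex.ofReal_sub, Complex.norm_real,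
    Real.norm_eq_abs] using hvertex

lemma ringPotential_nonneg (ℓ : ℕ) (x y : ℝ) : 0 ≤ ringPotential ℓ x y :=
  sum_nonneg fun _ _ => by positivity

section RingBounds

variable {ℓ : ℕ} {m₀ μ lam x : ℝ}

lemma div_le_ringEnergy (hμ : 0 ≤ μ) (hlam : lam ≤ 0) :
    μ * (m₀ + μ * ringForce ℓ 1 1) / x ≤ ringEnergy ℓ m₀ μ lam x := by
  have hinertia : 0 ≤ -lam / 2 * μ * x ^ 2 := by have := neg_nonneg.2 hlam; positivity
  rw [ringEnergy]
  linarith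

lemma mul_sq_le_ringEnergy (hA : 0 ≤ m₀ + μ * ringForce ℓ 1 1) (hμ : 0 ≤ μ) (hx : 0 ≤ x) :
    -lam / 2 * μ * x ^ 2 ≤ ringEnergy ℓ m₀ μ lam x := by
  have hgrav : 0 ≤ μ * (m₀ + μ * ringForce ℓ 1 1) / x := by positivity
  rw [ringEnergy]
  linarith

lemma ringEnergy_nonneg (hA : 0 ≤ m₀ + μ * ringForce ℓ 1 1) (hμ : 0 ≤ μ) (hlam : lam ≤ 0)
    (hx : 0 ≤ x) : 0 ≤ ringEnergy ℓ m₀ μ lam x :=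
  (by positivity : 0 ≤ μ * (m₀ + μ * ringForce ℓ 1 1) / x).trans (div_le_ringEnergy hμ hlam)

end RingBounds

variable {n ℓ : ℕ} {m₀ lam : ℝ} {m r : Fin n → ℝ}

lemma ringEnergy_le_energy (hA : ∀ i, 0 ≤ m₀ + m i * ringForce ℓ 1 1) (hm : ∀ i, 0 ≤ m i)
    (hlam : lam ≤ 0) (hr : ∀ i, 0 ≤ r i) (i : Fin n) :
    ringEnergy ℓ m₀ (m i) lam (r i) ≤ energy ℓ m₀ m lam r := by
  have hring := single_le_sum (fun j _ => ringEnergy_nonneg (hA j) (hm j) hlam (hr j)) (mem_univ i)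
  have hpairs : 0 ≤ ∑ i, ∑ j ∈ Ioi i, m i * m j * ringPotential ℓ (r i) (r j) :=
    sum_nonneg fun i _ => sum_nonneg fun j _ =>
      mul_nonneg (mul_nonneg (hm i) (hm j)) (ringPotential_nonneg ℓ _ _)
  exact hring.trans (le_add_of_nonneg_right hpairs)

lemma mul_ringPotential_le_energy (hA : ∀ i, 0 ≤ m₀ + m i * ringForce ℓ 1 1) (hm : ∀ i, 0 ≤ m i)
    (hlam : lam ≤ 0) (hr : ∀ i, 0 ≤ r i) {i j : Fin n} (hij : i < j) :
    m i * m j * ringPotential ℓ (r i) (r j) ≤ energy ℓ m₀ m lam r := by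
  have hnonneg (i j : Fin n) : 0 ≤ m i * m j * ringPotential ℓ (r i) (r j) :=
    mul_nonneg (mul_nonneg (hm i) (hm j)) (ringPotential_nonneg ℓ _ _)
  have hrings : 0 ≤ ∑ i, ringEnergy ℓ m₀ (m i) lam (r i) :=
    sum_nonneg fun i _ => ringEnergy_nonneg (hA i) (hm i) hlam (hr i)
  calc m i * m j * ringPotential ℓ (r i) (r j)
      ≤ ∑ j ∈ Ioi i, m i * m j * ringPotential ℓ (r i) (r j) :=
        single_le_sum (fun j _ => hnonneg i j) (mem_Ioi.2 hij)
    _ ≤ ∑ i, ∑ j ∈ Ioi i, m i * m j * ringPotential ℓ (r i) (r j) :=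
        single_le_sum (f := fun i => ∑ j ∈ Ioi i, m i * m j * ringPotential ℓ (r i) (r j))
          (fun i _ => sum_nonneg fun j _ => hnonneg i j) (mem_univ i)
    _ ≤ energy ℓ m₀ m lam r := le_add_of_nonneg_left hrings

lemma exists_isCompact_subset_radii_of_energy_le [NeZero ℓ]
    (hA : ∀ i, 0 < m₀ + m i * ringForce ℓ 1 1) (hm : ∀ i, 0 < m i) (hlam : lam < 0) (C : ℝ) :
    ∃ K ⊆ radii n, IsCompact K ∧ ∀ r ∈ radii n, energy ℓ m₀ m lam r ≤ C → r ∈ K := by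
  wlog hC : 0 < C
  · obtain ⟨K, hKr, hK, hmem⟩ := this hA hm hlam (|C| + 1) (by positivity)
    exact ⟨K, hKr, hK, fun r hr hrC => hmem r hr (by linarith [le_abs_self C])⟩
  have hA' (i : Fin n) := (hA i).le
  have hm' (i : Fin n) := (hm i).le
  let a (i : Fin n) : ℝ := m i * (m₀ + m i * ringForce ℓ 1 1) / C
  let b (i : Fin n) : ℝ := √(C / (-lam / 2 * m i))
  let d (i j : Fin n) : ℝ := m i * m j / C
  refine ⟨{r | r ∈ Set.Icc a b ∧ ∀ i j, i < j → d i j ≤ r j - r i}, fun r ⟨hab, hd⟩ => ⟨?_, ?_⟩,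
    isCompact_setOf_gap_le a b d, fun r hr hrC => ?_⟩
  · exact fun i => (div_pos (mul_pos (hm i) (hA i)) hC).trans_le (hab.1 i)
  · exact fun i j hij => sub_pos.1 ((div_pos (mul_pos (hm i) (hm j)) hC).trans_le (hd i j hij))
  have hr' (i : Fin n) := (hr.1 i).le
  refine ⟨⟨fun i => ?_, fun i => ?_⟩, fun i j hij => ?_⟩
  · refine (div_le_comm₀ (hr.1 i) hC).1 ?_
    exact ((div_le_ringEnergy (hm' i) hlam.le).trans
      (ringEnergy_le_energy hA' hm' hlam.le hr' i)).trans hrC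
  · have hcoeff : 0 < -lam / 2 * m i := mul_pos (by linarith) (hm i)
    refine Real.le_sqrt_of_sq_le ((le_div_iff₀' hcoeff).2 ?_)
    exact ((mul_sq_le_ringEnergy (hA' i) (hm' i) (hr' i)).trans
      (ringEnergy_le_energy hA' hm' hlam.le hr' i)).trans hrC
  · have hgap : 0 < r j - r i := sub_pos.2 (hr.2 hij)
    refine (div_le_comm₀ hgap hC).1 ?_
    calc m i * m j / (r j - r i) = m i * m j * |r i - r j|⁻¹ := by
          rw [abs_sub_comm, abs_of_pos hgap, div_eq_mul_inv]
      _ ≤ m i * m j * ringPotential ℓ (r i) (r j) :=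
          mul_le_mul_of_nonneg_left (inv_abs_sub_le_ringPotential _ _)
            (mul_nonneg (hm' i) (hm' j))
      _ ≤ C := (mul_ringPotential_le_energy hA' hm' hlam.le hr' hij).trans hrC

lemma exists_isMinOn_energy [NeZero ℓ] (hA : ∀ i, 0 < m₀ + m i * ringForce ℓ 1 1)
    (hm : ∀ i, 0 < m i) (hlam : lam < 0) :
    ∃ r ∈ radii n, IsMinOn (energy ℓ m₀ m lam) (radii n) r := by
  obtain ⟨r₀, hr₀⟩ := radii_nonempty n
  obtain ⟨K, hKr, hK, hmem⟩ :=
    exists_isCompact_subset_radii_of_energy_le hA hm hlam (energy ℓ m₀ m lam r₀)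
  have hcont : ContinuousOn (energy ℓ m₀ m lam) (radii n) := fun r hr =>
    (hasFDerivAt_energy m₀ m lam hr).continuousAt.continuousWithinAt
  obtain ⟨r, hrK, hmin⟩ := hK.exists_isMinOn ⟨r₀, hmem r₀ hr₀ le_rfl⟩ (hcont.mono hKr)
  refine ⟨r, hKr hrK, fun s hs => ?_⟩
  rcases le_total (energy ℓ m₀ m lam s) (energy ℓ m₀ m lam r₀) with h | h
  · exact hmin (hmem s hs h)
  · exact (hmin (hmem r₀ hr₀ le_rfl)).trans h

end Existence

section Uniqueness

lemma hasFDerivAt_comp_exp_zero {ι : Type*} [Finite ι] {F : (ι → ℝ) → ℝ} {r : ι → ℝ}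
    (hr : ∀ i, 0 < r i) (hF : HasFDerivAt F (0 : (ι → ℝ) →L[ℝ] ℝ) r) :
    HasFDerivAt (fun u => F fun i => Real.exp (u i)) (0 : (ι → ℝ) →L[ℝ] ℝ)
      fun i => Real.log (r i) := by
  have := Fintype.ofFinite ι
  have hexp : HasFDerivAt (fun (u : ι → ℝ) i => Real.exp (u i)) _ fun i => Real.log (r i) :=
    hasFDerivAt_pi.2 fun i => (hasFDerivAt_apply i _).exp
  rw [← funext fun i => Real.exp_log (hr i)] at hF
  exact (hF.comp _ hexp).congr_fderiv (ContinuousLinearMap.zero_comp _)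

variable {n ℓ : ℕ} {m₀ lam : ℝ} {m r s : Fin n → ℝ}

lemma eq_of_hasFDerivAt_energy_zero (hA : ∀ i, 0 ≤ m₀ + m i * ringForce ℓ 1 1)
    (hm : ∀ i, 0 < m i) (hlam : lam < 0) (hr : r ∈ radii n) (hs : s ∈ radii n)
    (hdr : HasFDerivAt (energy ℓ m₀ m lam) (0 : (Fin n → ℝ) →L[ℝ] ℝ) r)
    (hds : HasFDerivAt (energy ℓ m₀ m lam) (0 : (Fin n → ℝ) →L[ℝ] ℝ) s) : r = s := by
  have hlog_mono {t : Fin n → ℝ} (ht : t ∈ radii n) : StrictMono fun i => Real.log (t i) :=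
    fun i j hij => Real.log_lt_log (ht.1 i) (ht.2 hij)
  have hlog := eq_of_strictConvexOn_of_hasFDerivAt_zero (strictConvexOn_energy_exp hA hm hlam)
    (hlog_mono hr) (hlog_mono hs) (hasFDerivAt_comp_exp_zero hr.1 hdr)
    (hasFDerivAt_comp_exp_zero hs.1 hds)
  exact funext fun i => Real.log_injOn_pos (hr.1 i) (hs.1 i) (congrFun hlog i)

end Uniqueness

end Spiderweb

end

/-- By similarity the attraction of the centre and of a ring of mass `μ` on the bodies of that ring
is `m₀ + μ * ringForce ℓ 1 1` divided by the square of its radius. -/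
theorem mainTheorem1_general {n ℓ : ℕ} {m₀ : ℝ} {m : Fin n → ℝ} {lam : ℝ} (hℓ : 2 ≤ ℓ)
    (hA : ∀ i, 0 < m₀ + m i * Spiderweb.ringForce ℓ 1 1) (hm : ∀ i, 0 < m i) (hlam : lam < 0) :
    ∃! r : Fin n → ℝ, r ∈ Spiderweb.radii n ∧ Spiderweb.IsCentralSpiderweb ℓ m₀ m lam r := by
  have : NeZero ℓ := ⟨by lia⟩
  have hcritical {r : Fin n → ℝ} (hr : r ∈ Spiderweb.radii n) :=
    Spiderweb.isCentralSpiderweb_iff_hasFDerivAt_energy_zero (m₀ := m₀) (lam := lam) hℓ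
      (fun i => (hm i).ne') hr
  obtain ⟨r, hr, hmin⟩ := Spiderweb.exists_isMinOn_energy hA hm hlam
  have hdr := Spiderweb.hasFDerivAt_energy (ℓ := ℓ) m₀ m lam hr
  rw [(hmin.isLocalMin ((Spiderweb.isOpen_radii n).mem_nhds hr)).hasFDerivAt_eq_zero hdr] at hdr
  refine ⟨r, ⟨hr, (hcritical hr).2 hdr⟩, fun s ⟨hs, hcentral⟩ => ?_⟩
  exact Spiderweb.eq_of_hasFDerivAt_energy_zero (fun i => (hA i).le) hm hlam hs hr
    ((hcritical hs).1 hcentral) hdr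

theorem mainTheorem1 (n ℓ : ℕ) (m₀ : ℝ) (m : Fin n → ℝ) (lam : ℝ)
    (hm₀ : 0 ≤ m₀) (hm : ∀ i, 0 < m i) (hlam : lam < 0) :
    (2 ≤ ℓ ∧ ℓ ≤ 9 →
      ∃! r : Fin n → ℝ, r ∈ Spiderweb.radii n ∧ Spiderweb.IsCentralSpiderweb ℓ m₀ m lam r) ∧
    (Antitone m →
      ((ℓ = 10 ∧ n ≤ 17) ∨ (ℓ = 11 ∧ n ≤ 9) ∨ (ℓ = 12 ∧ n ≤ 6) ∨ (ℓ = 13 ∧ n ≤ 5) ∨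
        ((ℓ = 14 ∨ ℓ = 15) ∧ n ≤ 4) ∨ ((ℓ = 16 ∨ ℓ = 17 ∨ ℓ = 18) ∧ n ≤ 3)) →
      ∃! r : Fin n → ℝ, r ∈ Spiderweb.radii n ∧ Spiderweb.IsCentralSpiderweb ℓ m₀ m lam r) := by
  have hA (hℓ : 2 ≤ ℓ) (i : Fin n) : 0 < m₀ + m i * Spiderweb.ringForce ℓ 1 1 :=
    add_pos_of_nonneg_of_pos hm₀ (mul_pos (hm i) (Spiderweb.ringForce_one_one_pos hℓ))
  exact ⟨fun h => mainTheorem1_general h.1 (hA h.1) hm hlam,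
    fun _ h => mainTheorem1_general (by lia) (hA (by lia)) hm hlam⟩
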